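/- Let $X$ be a complex Banach space and $L(X)$ the algebra of bounded linear operators on $X$. Let $\sigma_*$ be one of the following three spectra: the spectrum $\sigma$; the Browder spectrum $\sigma_b(T)=\{\lambda\in\mathbb C: T-\lambda I$ is not a Fredholm operator of finite ascent and finite descent$\}$; the Drazin spectrum $\sigma_d(T)=\{\lambda\in\mathbb C: T-\lambda I$ is not Drazin invertible$\}$ (an operator $A$ is Drazin invertible if there are a bounded operator $S$ and $k\in\mathbb N$ with $AS=SA$, $SAS=S$ and $A^{k+1}S=A^k$). For $A\subset\mathbb C$ let $\operatorname{acc}A$ be the set of accumulation points of $A$ in $\mathbb C$, and define by transfinite recursion $\operatorname{acc}^0A=A$, $\operatorname{acc}^{\alpha+1}A=\operatorname{acc}(\operatorname{acc}^\alpha A)$, and $\operatorname{acc}^\alpha A=\bigcap_{\beta<\alpha}\operatorname{acc}^\beta A$ for a limit ordinal $\alpha$. The Cantor–Bendixson rank $\operatorname{CBR}(A)$ is the least ordinal $\alpha$ with $\operatorname{acc}^\alpha A=\operatorname{acc}^{\alpha+1}A$. Let $\omega_1$ be the first uncountable ordinal. For $T\in L(X)$ write $(M,N)\in\operatorname{Red}(T)$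 if $M,N$ are closed $T$-invariant subspaces with $X=M\oplus N$, and let $T_M,T_N$ be the restrictions of $T$. Call $T$ *almost invertible* if there is $(M,N)\in\operatorname{Red}(T)$ such that $T_M$ is invertible and $\sigma(T_N)$ is at most countable, and put $\sigma_{al}(T)=\{\lambda\in\mathbb C: T-\lambda I\text{ is not almost invertible}\}$. Call $T$ $g_{\sigma_*}^{0}$-*invertible* if $0\notin\sigma_*(T)$; $g_{\sigma_*}^{\beta+1}$-*invertible* if there is $(M,N)\in\operatorname{Red}(T)$ such that $T_M$ is invertible and $\operatorname{acc}^{\beta}\sigma_*(T_N)\subset\{0\}$; and, for a limit ordinal $\alpha$, $g_{\sigma_*}^{\alpha}$-*invertible* if it is $g_{\sigma_*}^{\beta}$-invertible for some successor ordinal $\beta<\alpha$. **Theorem.** Let $T\in L(X)$ and $r_*=\operatorname{CBR}(\sigma_*(T))$. Then $T$ is almost invertible if and only if $T$ is $g_{\sigma_*}^{\omega_1}$-invertible, if and only if $T$ is $g_{\sigma_*}^{r_*}$-invertible. Consequently the set of almost invertible operators in $L(X)$, the set of $g_{\sigma_*}^{\omega_1}$-invertible operators, and the set of operators $T$ that are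 $g_{\sigma_*}^{r_*}$-invertible with $r_*=\operatorname{CBR}(\sigma_*(T))$ coincide, and for every $T\in L(X)$ $$\sigma_{al}(T)=\operatorname{acc}^{\omega_1}\sigma_*(T)=\operatorname{acc}^{r_*}\sigma_*(T).$$ In particular, $T$ is almost invertible if and only if $0\notin\operatorname{acc}^{\omega_1}\sigma(T)$. -/

import Mathlib

open scoped Ordinal

noncomputable section

namespace AlmostInv

/-! ### Cantor–Bendixson derivatives of subsets of the complex plane -/

/-- The `α`-th Cantor–Bendixson derivative `acc^α A` of `A ⊆ ℂ`: `acc^0 A = A`,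
`acc^(α+1) A = acc (acc^α A)`, and `acc^α A = ⋂ β < α, acc^β A` for `α` a limit ordinal, where
`acc` is the set of accumulation points in `ℂ`. -/
def accIter (A : Set ℂ) (α : Ordinal.{0}) : Set ℂ :=
  Ordinal.limitRecOn (motive := fun _ => Set ℂ) α A
    (fun _ S => derivedSet S)
    (fun γ _ S => ⋂ (β : Ordinal.{0}) (h : β < γ), S β h)

theorem accIter_zero (A : Set ℂ) : accIter A 0 = A :=
  Ordinal.limitRecOn_zero ..

theorem accIter_add_one (A : Set ℂ) (α : Ordinal.{0}) :
    accIter A (α + 1) = derivedSet (accIter A α) :=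
  Ordinal.limitRecOn_add_one ..

theorem accIter_limit (A : Set ℂ) {α : Ordinal.{0}} (hα : Order.IsSuccLimit α) :
    accIter A α = ⋂ (β : Ordinal.{0}) (_ : β < α), accIter A β :=
  Ordinal.limitRecOn_limit _ _ _ _ hα

/-- On closed sets, `accIter` is the iterated derived set of Mathlib. -/
theorem accIter_eq_iteratedDerivedSet {A : Set ℂ} (hA : IsClosed A) (α : Ordinal.{0}) :
    accIter A α = CantorBendixson.iteratedDerivedSet A α := by
  induction α using Ordinal.limitRecOn with
  | zero => rw [accIter_zero, CantorBendixson.iteratedDerivedSet_zero]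
  | add_one a ih =>
    rw [accIter_add_one, CantorBendixson.iteratedDerivedSet_succ, ih,
      (CantorBendixson.isClosed_iteratedDerivedSet hA a).relDerivedSet_eq]
  | limit a ha ih =>
    rw [accIter_limit A ha, CantorBendixson.iteratedDerivedSet_limit ha]
    ext x
    simp only [Set.mem_iInter, Subtype.forall, Set.mem_Iio]
    exact forall₂_congr fun b hb => by rw [ih b hb]

/-- The Cantor–Bendixson rank of `A`: the least ordinal `α` with `acc^α A = acc^(α+1) A`. -/
def cbRank (A : Set ℂ) : Ordinal.{0} :=
  sInf {α : Ordinal.{0} | accIter A α = accIter A (α + 1)}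

/-- The set over which the infimum defining the rank is taken is nonempty for closed sets, so that
the rank is really attained. -/
theorem accIter_cbRank {A : Set ℂ} (hA : IsClosed A) :
    accIter A (cbRank A) = accIter A (cbRank A + 1) := by
  have h : {α : Ordinal.{0} | accIter A α = accIter A (α + 1)}.Nonempty := by
    obtain ⟨a, ha⟩ := CantorBendixson.iteratedDerivedSet_mem_fixedPoints A
    refine ⟨a, ?_⟩
    rw [Set.mem_ofPred_eq, accIter_eq_iteratedDerivedSet hA, accIter_eq_iteratedDerivedSet hA,
      CantorBendixson.iteratedDerivedSet_succ]
    exact (Function.mem_fixedPoints_iff.mp ha).symm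
  exact csInf_mem h

/-! ### Spectra -/

section Spectra

variable {E : Type*} [NormedAddCommGroup E] [NormedSpace ℂ E]

/-- `T` has finite ascent: `N(T^n) = N(T^(n+1))` for some `n`. -/
def HasFiniteAscent (T : E →L[ℂ] E) : Prop :=
  ∃ n : ℕ, (T ^ n).ker = (T ^ (n + 1)).ker

/-- `T` has finite descent: `R(T^n) = R(T^(n+1))` for some `n`. -/
def HasFiniteDescent (T : E →L[ℂ] E) : Prop :=
  ∃ n : ℕ, (T ^ n).range = (T ^ (n + 1)).range

/-- `T` is a Browder operator: Fredholm of finite ascent and finite descent. -/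
def IsBrowder (T : E →L[ℂ] E) : Prop :=
  T.IsFredholm ∧ HasFiniteAscent T ∧ HasFiniteDescent T

/-- `T` is Drazin invertible: it has a Drazin inverse, i.e. there is a bounded operator `S` with
`TS = ST`, `STS = S` and `T^(k+1) S = T^k` for some `k ≥ 0`. -/
def IsDrazinInvertible (T : E →L[ℂ] E) : Prop :=
  ∃ S : E →L[ℂ] E, T * S = S * T ∧ S * T * S = S ∧ ∃ k : ℕ, T ^ (k + 1) * S = T ^ k

/-- The Browder spectrum. -/
def browderSpectrum (T : E →L[ℂ] E) : Set ℂ :=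
  {z : ℂ | ¬ IsBrowder (T - z • (1 : E →L[ℂ] E))}

/-- The Drazin spectrum. -/
def drazinSpectrum (T : E →L[ℂ] E) : Set ℂ :=
  {z : ℂ | ¬ IsDrazinInvertible (T - z • (1 : E →L[ℂ] E))}

end Spectra

/-- The three possible choices of `σ_*`. -/
inductive SpectrumKind : Type
  | ordinary
  | browder
  | drazin

/-- `σ_*(T)`, where `σ_*` is the spectrum, the Browder spectrum or the Drazin spectrum. -/
def sigmaStar (k : SpectrumKind) {E : Type*} [NormedAddCommGroup E] [NormedSpace ℂ E]
    (T : E →L[ℂ] E) : Set ℂ :=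
  match k with
  | .ordinary => spectrum ℂ T
  | .browder => browderSpectrum T
  | .drazin => drazinSpectrum T

/-! ### Decompositions and the classes of operators -/

section Classes

variable {X : Type*} [NormedAddCommGroup X] [NormedSpace ℂ X]

/-- `(M, N) ∈ Red(T)`: `M` and `N` are closed `T`-invariant subspaces with `X = M ⊕ N`. -/
structure Red (T : X →L[ℂ] X) (M N : Submodule ℂ X) : Prop where
  isClosed_left : IsClosed (M : Set X)
  isClosed_right : IsClosed (N : Set X)
  invariant_left : ∀ x ∈ M, T x ∈ M
  invariant_right : ∀ x ∈ N, T x ∈ N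
  isCompl : IsCompl M N

/-- `T` is almost invertible: there is `(M, N) ∈ Red(T)` such that `T_M` is invertible and
`σ(T_N)` is at most countable. -/
def AlmostInvertible (T : X →L[ℂ] X) : Prop :=
  ∃ (M N : Submodule ℂ X) (h : Red T M N),
    IsUnit (T.restrict h.invariant_left) ∧
    (spectrum ℂ (T.restrict h.invariant_right)).Countable

/-- `σ_al(T)`, the set of `z ∈ ℂ` such that `T - zI` is not almost invertible. -/
def sigmaAl (T : X →L[ℂ] X) : Set ℂ :=
  {z : ℂ | ¬ AlmostInvertible (T - z • (1 : X →L[ℂ] X))}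

/-- `g^(β+1)`-invertibility with respect to `σ_*`: there is `(M, N) ∈ Red(T)` such that `T_M` is
invertible and `acc^β σ_*(T_N) ⊆ {0}`. -/
def GInvertibleSucc (k : SpectrumKind) (T : X →L[ℂ] X) (β : Ordinal.{0}) : Prop :=
  ∃ (M N : Submodule ℂ X) (h : Red T M N),
    IsUnit (T.restrict h.invariant_left) ∧
    accIter (sigmaStar k (T.restrict h.invariant_right)) β ⊆ {0}

/-- `g^α`-invertibility with respect to `σ_*`. For `α = 0` it means `0 ∉ σ_*(T)`; for a successor
`α = β + 1` it is `GInvertibleSucc k T β`; for a limit ordinal `α` it means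
`g^(β+1)`-invertibility for some successor ordinal `β + 1 < α`. -/
def GInvertible (k : SpectrumKind) (T : X →L[ℂ] X) (α : Ordinal.{0}) : Prop :=
  (α = 0 ∧ (0 : ℂ) ∉ sigmaStar k T) ∨
  (∃ β : Ordinal.{0}, α = β + 1 ∧ GInvertibleSucc k T β) ∨
  (Order.IsSuccLimit α ∧ ∃ β : Ordinal.{0}, β + 1 < α ∧ GInvertibleSucc k T β)

end Classes

end AlmostInv

end

/-!
By the Cantor–Bendixson theorem a closed set `A ⊆ ℂ` loses only countably many points on its way to
its perfect kernel, which it reaches before stage `ω₁`. A nonempty perfect set is uncountable, so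
`0 ∉ acc^ω₁ A` means exactly that `A` is countable near `0`.

The three spectra differ by points isolated in `σ(T)`, of which there are countably many, since
`T - z` is invertible for small `z ≠ 0` when `T` is Drazin invertible; and a Browder operator is the
same as a Drazin invertible Fredholm operator. Moreover `σ_*(T) = σ_*(T_M) ∪ σ_*(T_N)` for
`(M, N) ∈ Red(T)`, so `σ_*(T)` and `σ_*(T_N)`, hence also their derivatives, agree near `0` when
`T_M` is invertible. Conversely, if `σ_*(T)` is countable near `0`, then so is `σ(T)`, and
arbitrarily small circles around `0` avoid it. The Riesz projection of such a circle splits off the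
part `T_N` of `T` with spectrum inside the circle and leaves an invertible `T_M`. Applied at every
stage of the derivation, this gives that `T` is `g^α`-invertible if and only if `0 ∉ acc^α σ_*(T)`.
-/

noncomputable section

namespace AlmostInv

/-! ### The Cantor–Bendixson theorem -/

section CantorBendixson

open CantorBendixson Filter Function Set Topology

universe u

variable {X : Type u} [TopologicalSpace X] {s t : Set X}

theorem exists_mem_iteratedDerivedSet_notMem_relDerivedSet {x : X} (hx : x ∈ s)
    {a : Ordinal.{u}} (ha : x ∉ sᵈ[a]) : ∃ b < a, x ∈ sᵈ[b] \ relDerivedSet sᵈ[b] := by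
  induction a using Ordinal.limitRecOn with
  | zero => exact absurd hx (by rwa [iteratedDerivedSet_zero] at ha)
  | add_one a ih =>
    rw [iteratedDerivedSet_succ] at ha
    by_cases h : x ∈ sᵈ[a]
    · exact ⟨a, lt_add_one a, h, ha⟩
    · obtain ⟨b, hb, hxb⟩ := ih h
      exact ⟨b, hb.trans (lt_add_one a), hxb⟩
  | limit a hlim ih =>
    rw [iteratedDerivedSet_limit hlim, mem_iInter, not_forall] at ha
    obtain ⟨⟨b, hb⟩, hxb⟩ := ha
    obtain ⟨c, hc, hxc⟩ := ih b hb hxb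
    exact ⟨c, hc.trans hb, hxc⟩

theorem exists_mem_countableBasis_inter_subset_singleton [SecondCountableTopology X] {x : X}
    (hx : x ∈ s \ relDerivedSet s) :
    ∃ V ∈ TopologicalSpace.countableBasis X, x ∈ V ∧ V ∩ s ⊆ {x} := by
  have hacc : ¬ AccPt x (𝓟 s) := fun h => hx.2 ⟨h, hx.1⟩
  rw [accPt_iff_nhds] at hacc
  push Not at hacc
  obtain ⟨U, hU, hUx⟩ := hacc
  obtain ⟨V, hV, hxV, hVU⟩ := (TopologicalSpace.isBasis_countableBasis X).mem_nhds_iff.1 hU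
  exact ⟨V, hV, hxV, fun y hy => hUx y ⟨hVU hy.1, hy.2⟩⟩

-- A point that disappears at stage `b` is isolated in `sᵈ[b]`; a basic open set isolating it there
-- cannot isolate another point at a later stage.
theorem countable_diff_iteratedDerivedSet [SecondCountableTopology X] (s : Set X)
    (a : Ordinal.{u}) : (s \ sᵈ[a]).Countable := by
  have isolated : ∀ x ∈ s \ sᵈ[a], ∃ b : Ordinal.{u}, x ∈ sᵈ[b] ∧
      ∃ V ∈ TopologicalSpace.countableBasis X, x ∈ V ∧ V ∩ sᵈ[b] ⊆ {x} := fun x hx => by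
    obtain ⟨b, -, hb⟩ := exists_mem_iteratedDerivedSet_notMem_relDerivedSet hx.1 hx.2
    exact ⟨b, hb.1, exists_mem_countableBasis_inter_subset_singleton hb⟩
  choose! b hb V hV hxV hVx using isolated
  refine MapsTo.countable_of_injOn (f := V) hV ?_ (TopologicalSpace.countable_countableBasis X)
  intro x hx y hy hxy
  rcases le_total (b x) (b y) with h | h
  · exact (hVx x hx ⟨hxy ▸ hxV y hy, iteratedDerivedSet_antitone s h (hb y hy)⟩).symm
  · exact hVx y hy ⟨hxy ▸ hxV x hx, iteratedDerivedSet_antitone s h (hb x hx)⟩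

theorem not_countable_Iio_omega_one : ¬ (Iio (ω₁ : Ordinal.{u})).Countable := fun h => by
  have hcard := h.le_aleph0
  rw [Cardinal.mk_Iio_ordinal, ← Cardinal.lift_aleph0.{u + 1, u}, Cardinal.lift_le,
    Ordinal.card_omega] at hcard
  exact hcard.not_gt Cardinal.aleph0_lt_aleph_one

theorem exists_lt_omega_one_iteratedDerivedSet_mem_fixedPoints [SecondCountableTopology X]
    (s : Set X) : ∃ a < (ω₁ : Ordinal.{u}), sᵈ[a] ∈ fixedPoints relDerivedSet := by
  by_contra! hne
  have drops : ∀ a : Iio (ω₁ : Ordinal.{u}), ∃ x ∈ sᵈ[a], x ∉ sᵈ[a + 1] := fun a => by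
    refine exists_of_ssubset ((iteratedDerivedSet_antitone s (le_add_right le_rfl)).ssubset_of_ne
      fun h => hne a a.2 (mem_fixedPoints_of_iteratedDerivedSet_succ_eq h))
  choose f hf hf' using drops
  have injective : Injective f := .of_lt_imp_ne fun a b hab h =>
    hf' a (h ▸ iteratedDerivedSet_antitone s (Order.add_one_le_of_lt hab) (hf b))
  have mem_diff : ∀ a, f a ∈ s \ sᵈ[ω₁] := fun a =>
    ⟨by simpa using iteratedDerivedSet_antitone s zero_le (hf a),
      fun h => hf' a (iteratedDerivedSet_antitone s (Order.add_one_le_of_lt a.2) h)⟩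
  have := (countable_diff_iteratedDerivedSet s ω₁).to_subtype
  exact not_countable_Iio_omega_one (injective.codRestrict mem_diff).countable

theorem iteratedDerivedSet_eq_perfectKernel_of_le {a b : Ordinal.{u}}
    (ha : sᵈ[a] ∈ fixedPoints relDerivedSet) (hab : a ≤ b) : sᵈ[b] = perfectKernel s := by
  refine subset_antisymm ?_ (perfectKernel_subset_iteratedDerivedSet s b)
  rw [perfectKernel_eq_iteratedDerivedSet_of_mem_fixedPoints ha]
  exact iteratedDerivedSet_antitone s hab

theorem countable_diff_perfectKernel [SecondCountableTopology X] (s : Set X) :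
    (s \ perfectKernel s).Countable := by
  obtain ⟨a, -, ha⟩ := exists_lt_omega_one_iteratedDerivedSet_mem_fixedPoints s
  rw [perfectKernel_eq_iteratedDerivedSet_of_mem_fixedPoints ha]
  exact countable_diff_iteratedDerivedSet s a

theorem not_countable_of_perfect [PolishSpace X] (hs : Perfect s) (hne : s.Nonempty) :
    ¬ s.Countable := fun hc => by
  let := TopologicalSpace.upgradeIsCompletelyMetrizable X
  obtain ⟨f, hfs, -, hf⟩ := hs.exists_nat_bool_injection hne
  have := hc.to_subtype
  have uncountable : Uncountable (ℕ → Bool) := by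
    rw [← Cardinal.aleph0_lt_mk_iff]
    simpa using Cardinal.aleph0_lt_continuum
  exact not_countable (α := ℕ → Bool)
    (hf.codRestrict fun x => hfs (mem_range_self x)).countable

theorem notMem_perfectKernel_iff [PolishSpace X] (hs : IsClosed s) {x : X} :
    x ∉ perfectKernel s ↔ ∃ U ∈ 𝓝 x, (s ∩ U).Countable := by
  constructor
  · exact fun hx => ⟨_, (isClosed_perfectKernel hs).isOpen_compl.mem_nhds hx,
      countable_diff_perfectKernel s⟩
  · rintro ⟨U, hU, hc⟩ hx
    obtain ⟨V, hV, hVc, hVU⟩ := exists_mem_nhds_isClosed_subset hU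
    obtain ⟨hperf, hne⟩ := (perfect_perfectKernel hs).closure_nhds_inter x hx
      (mem_interior_iff_mem_nhds.2 hV) isOpen_interior
    refine not_countable_of_perfect hperf hne (hc.mono (subset_inter ?_ ?_))
    · exact closure_minimal (inter_subset_right.trans (perfectKernel_subset s)) hs
    · exact (closure_minimal (inter_subset_left.trans interior_subset) hVc).trans hVU

end CantorBendixson

section AccIter

open CantorBendixson Set

theorem derivedSet_preimage_homeomorph {Y Z : Type*} [TopologicalSpace Y] [TopologicalSpace Z]
    (e : Y ≃ₜ Z) (A : Set Z) : derivedSet (e ⁻¹' A) = e ⁻¹' derivedSet A := by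
  refine subset_antisymm ?_ ?_
  · simpa [image_subset_iff] using e.continuous.image_derivedSet (A := e ⁻¹' A) e.injective
  · simpa [image_subset_iff, ← e.image_symm] using
      e.symm.continuous.image_derivedSet (A := A) e.symm.injective

variable {A B : Set ℂ}

theorem accIter_antitone (hA : IsClosed A) : Antitone (accIter A) := fun α β h => by
  simpa only [accIter_eq_iteratedDerivedSet hA] using iteratedDerivedSet_antitone A h

theorem accIter_subset (hA : IsClosed A) (α : Ordinal.{0}) : accIter A α ⊆ A :=
  (accIter_antitone hA zero_le).trans_eq (accIter_zero A)

theorem accIter_inter_subset {U : Set ℂ} (hU : IsOpen U) (h : A ∩ U ⊆ B) (α : Ordinal.{0}) :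
    accIter A α ∩ U ⊆ accIter B α := by
  induction α using Ordinal.limitRecOn with
  | zero => simpa only [accIter_zero] using h
  | add_one a ih =>
    rw [accIter_add_one, accIter_add_one]
    rintro x ⟨hx, hxU⟩
    refine ((mem_derivedSet.1 hx).nhds_inter (hU.mem_nhds hxU)).mono ?_
    rw [inter_comm]
    exact Filter.principal_mono.2 ih
  | limit a ha ih =>
    rw [accIter_limit A ha, accIter_limit B ha]
    rintro x ⟨hx, hxU⟩
    simp only [mem_iInter] at hx ⊢
    exact fun b hb => ih b hb ⟨hx b hb, hxU⟩

theorem accIter_mono (h : A ⊆ B) (α : Ordinal.{0}) : accIter A α ⊆ accIter B α := by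
  simpa using accIter_inter_subset isOpen_univ (inter_subset_left.trans h) α

theorem accIter_preimage_homeomorph (e : ℂ ≃ₜ ℂ) (A : Set ℂ) (α : Ordinal.{0}) :
    accIter (e ⁻¹' A) α = e ⁻¹' accIter A α := by
  induction α using Ordinal.limitRecOn with
  | zero => simp only [accIter_zero]
  | add_one a ih => rw [accIter_add_one, accIter_add_one, ih, derivedSet_preimage_homeomorph]
  | limit a ha ih =>
    simp only [accIter_limit _ ha, preimage_iInter]
    exact iInter₂_congr ih

theorem countable_diff_accIter (hA : IsClosed A) (α : Ordinal.{0}) :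
    (A \ accIter A α).Countable := by
  rw [accIter_eq_iteratedDerivedSet hA]
  exact countable_diff_iteratedDerivedSet A α

theorem accIter_eq_perfectKernel_of_cbRank_le (hA : IsClosed A) {α : Ordinal.{0}}
    (h : cbRank A ≤ α) : accIter A α = perfectKernel A := by
  rw [accIter_eq_iteratedDerivedSet hA]
  refine iteratedDerivedSet_eq_perfectKernel_of_le
    (mem_fixedPoints_of_iteratedDerivedSet_succ_eq ?_) h
  rw [← accIter_eq_iteratedDerivedSet hA, ← accIter_eq_iteratedDerivedSet hA, accIter_cbRank hA]

theorem cbRank_lt_omega_one (hA : IsClosed A) : cbRank A < ω₁ := by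
  obtain ⟨a, ha, hfix⟩ := exists_lt_omega_one_iteratedDerivedSet_mem_fixedPoints A
  refine (csInf_le' ?_).trans_lt ha
  rw [Set.mem_ofPred_eq, accIter_eq_iteratedDerivedSet hA, accIter_eq_iteratedDerivedSet hA,
    iteratedDerivedSet_succ]
  exact hfix.symm

theorem accIter_omega_one (hA : IsClosed A) : accIter A ω₁ = perfectKernel A :=
  accIter_eq_perfectKernel_of_cbRank_le hA (cbRank_lt_omega_one hA).le

theorem accIter_cbRank_eq_omega_one (hA : IsClosed A) : accIter A (cbRank A) = accIter A ω₁ := by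
  rw [accIter_eq_perfectKernel_of_cbRank_le hA le_rfl, accIter_omega_one hA]

end AccIter

/-! ### Riesz projections -/

section CircleIntegral

open Complex Metric Set
open scoped Real

theorem circleIntegral_clm_comp_comm {E F : Type*} [NormedAddCommGroup E] [NormedSpace ℂ E]
    [CompleteSpace E] [NormedAddCommGroup F] [NormedSpace ℂ F] [CompleteSpace F] (L : E →L[ℂ] F)
    {f : ℂ → E} {c : ℂ} {r : ℝ} (hf : CircleIntegrable f c r) :
    (∮ z in C(c, r), L (f z)) = L (∮ z in C(c, r), f z) := by
  simp only [circleIntegral]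
  rw [← L.intervalIntegral_comp_comm hf.out]
  simp only [map_smul]

theorem circleIntegral_comm {E : Type*} [NormedAddCommGroup E] [NormedSpace ℂ E]
    {f : ℂ → ℂ → E} {c d : ℂ} {r R : ℝ} (hr : 0 ≤ r) (hR : 0 ≤ R)
    (hf : ContinuousOn (Function.uncurry f) (sphere c r ×ˢ sphere d R)) :
    (∮ z in C(c, r), ∮ w in C(d, R), f z w) = ∮ w in C(d, R), ∮ z in C(c, r), f z w := by
  have hcont : Continuous (Function.uncurry fun θ φ : ℝ =>
      deriv (circleMap c r) θ • deriv (circleMap d R) φ •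
        f (circleMap c r θ) (circleMap d R φ)) := by
    have continuous_f : Continuous fun p : ℝ × ℝ => f (circleMap c r p.1) (circleMap d R p.2) :=
      hf.comp_continuous (f := fun p : ℝ × ℝ => (circleMap c r p.1, circleMap d R p.2))
        (by fun_prop) fun p =>
          ⟨circleMap_mem_sphere c hr _, circleMap_mem_sphere d hR _⟩
    have continuous_deriv (c : ℂ) (r : ℝ) : Continuous (deriv (circleMap c r)) := by
      simp only [funext (deriv_circleMap c r)]
      fun_prop
    exact ((continuous_deriv c r).comp continuous_fst).smul
      (((continuous_deriv d R).comp continuous_snd).smul continuous_f)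
  simp only [circleIntegral, ← intervalIntegral.integral_smul]
  rw [MeasureTheory.intervalIntegral_intervalIntegral_swap
    (hcont.continuousOn.integrableOn_compact (isCompact_uIcc.prod isCompact_uIcc) |>.mono_set
      (prod_mono uIoc_subset_uIcc uIoc_subset_uIcc))]
  simp only [smul_comm (deriv (circleMap d R) _)]

section NormedRing

variable {A : Type*} [NormedRing A] [NormedAlgebra ℂ A] [CompleteSpace A] {f : ℂ → A} {c : ℂ}
  {r : ℝ}

theorem mul_circleIntegral (b : A) (hf : CircleIntegrable f c r) :
    b * ∮ z in C(c, r), f z = ∮ z in C(c, r), b * f z :=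
  (circleIntegral_clm_comp_comm (ContinuousLinearMap.mul ℂ A b) hf).symm

theorem circleIntegral_mul (b : A) (hf : CircleIntegrable f c r) :
    (∮ z in C(c, r), f z) * b = ∮ z in C(c, r), f z * b :=
  (circleIntegral_clm_comp_comm ((ContinuousLinearMap.mul ℂ A).flip b) hf).symm

theorem commute_circleIntegral {b : A} (hr : 0 ≤ r) (hf : CircleIntegrable f c r)
    (h : ∀ z ∈ sphere c r, Commute b (f z)) : Commute b (∮ z in C(c, r), f z) := by
  rw [Commute, SemiconjBy, mul_circleIntegral b hf, circleIntegral_mul b hf]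
  exact circleIntegral.integral_congr hr h

end NormedRing

variable {c w : ℂ} {r : ℝ}

theorem sub_ne_zero_of_mem_sphere {z : ℂ} (hw : w ∉ sphere c r) (hz : z ∈ sphere c r) :
    w - z ≠ 0 :=
  sub_ne_zero.2 fun h => hw (h ▸ hz)

theorem continuousOn_inv_sub (hw : w ∉ sphere c r) :
    ContinuousOn (fun z => (w - z)⁻¹) (sphere c r) :=
  .inv₀ (by fun_prop) fun _ hz => sub_ne_zero_of_mem_sphere hw hz

theorem circleIntegral_inv_sub_of_notMem_closedBall (hr : 0 ≤ r) (hw : w ∉ closedBall c r) :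
    (∮ z in C(c, r), (w - z)⁻¹) = 0 := by
  refine DiffContOnCl.circleIntegral_eq_zero hr (DifferentiableOn.diffContOnCl ?_)
  exact .inv (by fun_prop) fun z hz =>
    sub_ne_zero.2 fun h => hw (h ▸ closure_ball_subset_closedBall hz)

theorem circleIntegral_inv_sub_of_mem_ball (hw : w ∈ ball c r) :
    (∮ z in C(c, r), (w - z)⁻¹) = -(2 * π * I) := by
  rw [← circleIntegral.integral_sub_inv_of_mem_ball hw, neg_eq_neg_one_mul, ← smul_eq_mul,
    ← circleIntegral.integral_smul]
  refine congrArg (circleIntegral · c r) (funext fun z => ?_)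
  rw [smul_eq_mul, ← neg_eq_neg_one_mul, ← inv_neg, neg_sub]

end CircleIntegral

theorem exists_gt_disjoint_annulus {α : Type*} [PseudoMetricSpace α] {c : α} {r : ℝ} {K : Set α}
    (hK : IsCompact K) (h : Disjoint (Metric.sphere c r) K) :
    ∃ R > r, Disjoint (Metric.closedBall c R \ Metric.ball c r) K := by
  have hclosed : IsClosed ((dist · c) '' K) :=
    (hK.image (continuous_id.dist continuous_const)).isClosed
  have hr : r ∉ (dist · c) '' K := fun ⟨z, hz, hzr⟩ => Set.disjoint_left.1 h hzr hz
  obtain ⟨R, hrR, hR⟩ := mem_nhdsGE_iff_exists_Icc_subset.1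
    (mem_nhdsWithin_of_mem_nhds (hclosed.isOpen_compl.mem_nhds hr))
  exact ⟨R, hrR, Set.disjoint_left.2 fun z hz hzK => hR ⟨not_lt.1 hz.2, hz.1⟩ ⟨z, hzK, rfl⟩⟩

section Resolvent

variable {A : Type*} [NormedRing A] [NormedAlgebra ℂ A] {a : A} {z : ℂ}

theorem mul_resolvent (hz : z ∈ resolventSet ℂ a) :
    (algebraMap ℂ A z - a) * resolvent a z = 1 :=
  Ring.mul_inverse_cancel _ hz

theorem resolvent_mul (hz : z ∈ resolventSet ℂ a) :
    resolvent a z * (algebraMap ℂ A z - a) = 1 :=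
  Ring.inverse_mul_cancel _ hz

theorem commute_resolvent (hz : z ∈ resolventSet ℂ a) : Commute a (resolvent a z) := by
  have h := (mul_resolvent hz).trans (resolvent_mul hz).symm
  rw [sub_mul, mul_sub, Algebra.commutes] at h
  exact sub_right_injective h

theorem continuousOn_resolvent [CompleteSpace A] (a : A) :
    ContinuousOn (resolvent a) (resolventSet ℂ a) :=
  fun _ hz => (spectrum.hasDerivAt_resolvent_const_left hz).continuousAt.continuousWithinAt

end Resolvent

section RieszProjection

open Complex Metric Set
open scoped Real

variable {A : Type*} [NormedRing A] [NormedAlgebra ℂ A]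

/-- The Riesz projection `(2πi)⁻¹ ∮ (z - a)⁻¹ dz` over the circle of centre `c` and radius `r`. It
splits off the part of the spectrum of `a` inside the circle; it is a junk value when the circle
meets the spectrum. -/
def rieszProjection (a : A) (c : ℂ) (r : ℝ) : A :=
  (2 * π * I : ℂ)⁻¹ • ∮ z in C(c, r), resolvent a z

/-- The Cauchy transform `w ↦ (2πi)⁻¹ ∮ (w - z)⁻¹ (z - a)⁻¹ dz` of the resolvent over a circle, that
is, the holomorphic functional calculus of `(w - z)⁻¹` on the part of the spectrum of `a` inside the
circle, when `w` is outside. It inverts `w - a` there, and on the complementary part for `w`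
inside. -/
def cauchyResolvent (a : A) (c : ℂ) (r : ℝ) (w : ℂ) : A :=
  (2 * π * I : ℂ)⁻¹ • ∮ z in C(c, r), (w - z)⁻¹ • resolvent a z

variable [CompleteSpace A] {a : A} {c w : ℂ} {r R : ℝ}

theorem circleIntegrable_resolvent (hr : 0 ≤ r) (h : sphere c r ⊆ resolventSet ℂ a) :
    CircleIntegrable (resolvent a) c r :=
  ((continuousOn_resolvent a).mono h).circleIntegrable hr

theorem circleIntegrable_inv_sub_smul_resolvent (hr : 0 ≤ r) (h : sphere c r ⊆ resolventSet ℂ a)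
    (hw : w ∉ sphere c r) : CircleIntegrable (fun z => (w - z)⁻¹ • resolvent a z) c r :=
  ((continuousOn_inv_sub hw).smul ((continuousOn_resolvent a).mono h)).circleIntegrable hr

theorem commute_rieszProjection (hr : 0 ≤ r) (h : sphere c r ⊆ resolventSet ℂ a) :
    Commute a (rieszProjection a c r) :=
  (commute_circleIntegral hr (circleIntegrable_resolvent hr h)
    fun _ hz => commute_resolvent (h hz)).smul_right _

theorem commute_cauchyResolvent (hr : 0 ≤ r) (h : sphere c r ⊆ resolventSet ℂ a)
    (hw : w ∉ sphere c r) : Commute a (cauchyResolvent a c r w) :=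
  (commute_circleIntegral hr (circleIntegrable_inv_sub_smul_resolvent hr h hw)
    fun _ hz => (commute_resolvent (h hz)).smul_right _).smul_right _

theorem sub_mul_cauchyResolvent (hr : 0 ≤ r) (h : sphere c r ⊆ resolventSet ℂ a)
    (hw : w ∉ sphere c r) :
    (algebraMap ℂ A w - a) * cauchyResolvent a c r w =
      rieszProjection a c r + ((2 * π * I : ℂ)⁻¹ * ∮ z in C(c, r), (w - z)⁻¹) • (1 : A) := by
  have integrand : ∀ z ∈ sphere c r, (algebraMap ℂ A w - a) * (w - z)⁻¹ • resolvent a z =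
      resolvent a z + (w - z)⁻¹ • (1 : A) := fun z hz => by
    have split : algebraMap ℂ A w - a = (w - z) • (1 : A) + (algebraMap ℂ A z - a) := by
      simp only [Algebra.algebraMap_eq_smul_one, sub_smul]
      abel
    rw [mul_smul_comm, split, add_mul, mul_resolvent (h hz), smul_one_mul, smul_add,
      inv_smul_smul₀ (sub_ne_zero_of_mem_sphere hw hz)]
  have integrable_inv : CircleIntegrable (fun z => (w - z)⁻¹ • (1 : A)) c r :=
    ((continuousOn_inv_sub hw).smul continuousOn_const).circleIntegrable hr
  rw [cauchyResolvent, rieszProjection, mul_smul_comm,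
    mul_circleIntegral _ (circleIntegrable_inv_sub_smul_resolvent hr h hw),
    circleIntegral.integral_congr hr integrand,
    circleIntegral.integral_add (circleIntegrable_resolvent hr h) integrable_inv,
    circleIntegral.integral_smul_const, smul_add, smul_smul]

theorem sub_mul_cauchyResolvent_of_notMem_closedBall (hr : 0 ≤ r)
    (h : sphere c r ⊆ resolventSet ℂ a) (hw : w ∉ closedBall c r) :
    (algebraMap ℂ A w - a) * cauchyResolvent a c r w = rieszProjection a c r := by
  rw [sub_mul_cauchyResolvent hr h (mt (sphere_subset_closedBall ·) hw),
    circleIntegral_inv_sub_of_notMem_closedBall hr hw, mul_zero, zero_smul, add_zero]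

theorem sub_mul_cauchyResolvent_of_mem_ball (h : sphere c r ⊆ resolventSet ℂ a)
    (hw : w ∈ ball c r) :
    (algebraMap ℂ A w - a) * cauchyResolvent a c r w = rieszProjection a c r - 1 := by
  rw [sub_mul_cauchyResolvent (dist_nonneg.trans hw.le) h (ne_of_lt hw),
    circleIntegral_inv_sub_of_mem_ball hw, mul_neg, inv_mul_cancel₀ two_pi_I_ne_zero, neg_smul,
    one_smul, sub_eq_add_neg]

theorem resolvent_mul_rieszProjection (hr : 0 ≤ r) (h : sphere c r ⊆ resolventSet ℂ a)
    (hw : w ∉ closedBall c r) (hwa : w ∈ resolventSet ℂ a) :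
    resolvent a w * rieszProjection a c r = cauchyResolvent a c r w := by
  rw [← sub_mul_cauchyResolvent_of_notMem_closedBall hr h hw, ← mul_assoc, resolvent_mul hwa,
    one_mul]

theorem rieszProjection_eq_of_annulus_subset (hr : 0 < r) (hrR : r ≤ R)
    (h : closedBall c R \ ball c r ⊆ resolventSet ℂ a) :
    rieszProjection a c R = rieszProjection a c r := by
  rw [rieszProjection, rieszProjection,
    circleIntegral_eq_of_differentiable_on_annulus_off_countable hr hrR countable_empty
      ((continuousOn_resolvent a).mono h)]
  exact fun z hz => (spectrum.hasDerivAt_resolvent_const_left (h ⟨ball_subset_closedBall hz.1.1,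
    mt (ball_subset_closedBall ·) hz.1.2⟩)).differentiableAt

theorem circleIntegral_cauchyResolvent (hr : 0 ≤ r) (hrR : r < R)
    (h : sphere c r ⊆ resolventSet ℂ a) :
    (∮ w in C(c, R), cauchyResolvent a c r w) = ∮ z in C(c, r), resolvent a z := by
  have sub_ne_zero : ∀ p ∈ sphere c R ×ˢ sphere c r, p.1 - p.2 ≠ 0 := fun p hp =>
    sub_ne_zero_of_mem_sphere (fun h' => hrR.ne (h'.symm.trans hp.1)) hp.2
  have winding : ∀ z ∈ sphere c r, (∮ w in C(c, R), (w - z)⁻¹ • resolvent a z) =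
      (2 * π * I : ℂ) • resolvent a z := fun z hz => by
    rw [circleIntegral.integral_smul_const, circleIntegral.integral_sub_inv_of_mem_ball]
    exact (mem_sphere.1 hz).trans_lt hrR
  simp only [cauchyResolvent]
  rw [circleIntegral.integral_smul, circleIntegral_comm (hr.trans hrR.le) hr,
    circleIntegral.integral_congr hr winding, circleIntegral.integral_smul,
    inv_smul_smul₀ two_pi_I_ne_zero]
  exact (ContinuousOn.inv₀ (by fun_prop) sub_ne_zero).smul
    (((continuousOn_resolvent a).mono h).comp continuousOn_snd fun p hp => hp.2)

-- Computing one factor of `p * p` over a slightly larger circle turns the product into the integral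
-- of the Cauchy transform.
theorem isIdempotentElem_rieszProjection (hr : 0 < r) (h : sphere c r ⊆ resolventSet ℂ a) :
    IsIdempotentElem (rieszProjection a c r) := by
  obtain ⟨R, hrR, hR⟩ := exists_gt_disjoint_annulus (spectrum.isCompact a)
    (disjoint_compl_right.mono_left h)
  replace hR : closedBall c R \ ball c r ⊆ resolventSet ℂ a :=
    fun z hz => not_not.1 (disjoint_left.1 hR hz)
  have sphere_subset : sphere c R ⊆ closedBall c R \ ball c r := fun z hz =>
    ⟨sphere_subset_closedBall hz, fun hz' => hrR.not_gt ((mem_sphere.1 hz).symm.trans_lt hz')⟩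
  have hR0 : 0 ≤ R := hr.le.trans hrR.le
  have product : ∀ w ∈ sphere c R,
      resolvent a w * rieszProjection a c r = cauchyResolvent a c r w := fun w hw =>
    resolvent_mul_rieszProjection hr.le h
      (fun hw' => hrR.not_ge ((mem_sphere.1 hw).symm.trans_le hw')) (hR (sphere_subset hw))
  calc rieszProjection a c r * rieszProjection a c r
      = rieszProjection a c R * rieszProjection a c r := by
        rw [rieszProjection_eq_of_annulus_subset hr hrR.le hR]
    _ = (2 * π * I : ℂ)⁻¹ • ∮ w in C(c, R), cauchyResolvent a c r w := by
        rw [rieszProjection, smul_mul_assoc,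
          circleIntegral_mul _ (circleIntegrable_resolvent hR0 (sphere_subset.trans hR)),
          circleIntegral.integral_congr hR0 product]
    _ = rieszProjection a c r := by
        rw [circleIntegral_cauchyResolvent hr.le hrR h, rieszProjection]

end RieszProjection

/-! ### Invariant decompositions -/

section TopCompl

open ContinuousLinearMap Submodule

variable {R X : Type*} [Ring R] [TopologicalSpace X] [AddCommGroup X] [Module R X]
  {M N : Submodule R X} {T A : X →L[R] X}

theorem range_invariant_of_commute (h : Commute T A) :
    ∀ x ∈ A.range, T x ∈ A.range := by
  rintro _ ⟨x, rfl⟩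
  exact ⟨T x, (DFunLike.congr_fun h.eq x).symm⟩

theorem ker_invariant_of_commute (h : Commute T A) :
    ∀ x ∈ A.ker, T x ∈ A.ker := fun x hx =>
  (DFunLike.congr_fun h.eq x).symm.trans ((congrArg T hx).trans (map_zero T))

variable [IsTopologicalAddGroup X]

/-- For `X = M ⊕ N` topologically, the operator of `X` given by a pair of operators of `M` and of
`N`. -/
def blockDiag (h : IsTopCompl M N) : (M →L[R] M) × (N →L[R] N) →+* (X →L[R] X) where
  toFun U := ofIsTopCompl h (M.subtypeL ∘L U.1) (N.subtypeL ∘L U.2)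
  map_one' := ofIsTopCompl_eq h (fun _ => rfl) fun _ => rfl
  map_mul' U V := ofIsTopCompl_eq h (fun x => by simp) fun x => by simp
  map_zero' := ofIsTopCompl_eq h (fun _ => rfl) fun _ => rfl
  map_add' U V := ofIsTopCompl_eq h (fun x => by simp) fun x => by simp

theorem blockDiag_restrict (h : IsTopCompl M N) (hM : ∀ x ∈ M, T x ∈ M) (hN : ∀ x ∈ N, T x ∈ N) :
    blockDiag h (T.restrict hM, T.restrict hN) = T :=
  ofIsTopCompl_eq h (fun _ => rfl) fun _ => rfl

theorem isUnit_of_isUnit_restrict (h : IsTopCompl M N) {hM : ∀ x ∈ M, T x ∈ M}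
    {hN : ∀ x ∈ N, T x ∈ N} (hTM : IsUnit (T.restrict hM)) (hTN : IsUnit (T.restrict hN)) :
    IsUnit T := by
  rw [← blockDiag_restrict h hM hN]
  exact (Prod.isUnit_iff.2 ⟨hTM, hTN⟩).map (blockDiag h)

/-- The compression to `M` of an operator of `X = M ⊕ N`. -/
def compression (h : IsTopCompl M N) : (X →L[R] X) →+ (M →L[R] M) where
  toFun A := M.projectionOntoL N h ∘L A ∘L M.subtypeL
  map_zero' := by ext; simp
  map_add' _ _ := by ext; simp

theorem compression_eq_one (h : IsTopCompl M N) (hA : ∀ x ∈ M, A x = x) :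
    compression h A = 1 := by
  ext x
  simp [compression, hA x x.2]

theorem compression_mul_right (h : IsTopCompl M N) (A : X →L[R] X) (hM : ∀ x ∈ M, T x ∈ M) :
    compression h (A * T) = compression h A * T.restrict hM :=
  rfl

theorem projectionOntoL_apply_of_invariant (h : IsTopCompl M N) (hM : ∀ x ∈ M, T x ∈ M)
    (hN : ∀ x ∈ N, T x ∈ N) (x : X) :
    M.projectionOntoL N h (T x) = T.restrict hM (M.projectionOntoL N h x) := by
  have apply_left (y : M) : M.projectionOntoL N h (T y) = T.restrict hM y :=
    projectionOntoL_apply_left h (T.restrict hM y)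
  have apply_right (y : N) : M.projectionOntoL N h (T y) = 0 :=
    projectionOntoL_apply_right h (T.restrict hN y)
  conv_lhs => rw [← projectionL_add_projectionL_eq_self h x]
  rw [map_add, map_add, ← coe_projectionOntoL_apply, ← coe_projectionOntoL_apply, apply_left,
    apply_right, add_zero]

theorem compression_mul_left (h : IsTopCompl M N) (A : X →L[R] X) (hM : ∀ x ∈ M, T x ∈ M)
    (hN : ∀ x ∈ N, T x ∈ N) : compression h (T * A) = T.restrict hM * compression h A :=
  ContinuousLinearMap.ext fun x => projectionOntoL_apply_of_invariant h hM hN (A x)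

theorem compression_pow_mul (h : IsTopCompl M N) (A : X →L[R] X) (hM : ∀ x ∈ M, T x ∈ M)
    (hN : ∀ x ∈ N, T x ∈ N) (n : ℕ) :
    compression h (T ^ n * A) = T.restrict hM ^ n * compression h A := by
  induction n with
  | zero => simp only [pow_zero, one_mul]
  | succ n ih =>
    rw [pow_succ', pow_succ', mul_assoc, mul_assoc, compression_mul_left h _ hM hN, ih]

theorem compression_pow (h : IsTopCompl M N) (hM : ∀ x ∈ M, T x ∈ M) (hN : ∀ x ∈ N, T x ∈ N)
    (n : ℕ) : compression h (T ^ n) = T.restrict hM ^ n := by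
  simpa only [mul_one, compression_eq_one h fun x _ => one_apply_eq_self x] using
    compression_pow_mul h 1 hM hN n

theorem isUnit_restrict (h : IsTopCompl M N) (hM : ∀ x ∈ M, T x ∈ M) (hN : ∀ x ∈ N, T x ∈ N)
    {S : X →L[R] X} (hTS : ∀ x ∈ M, T (S x) = x) (hST : ∀ x ∈ M, S (T x) = x) :
    IsUnit (T.restrict hM) := by
  refine isUnit_iff_exists.2 ⟨compression h S, ?_, ?_⟩
  · rw [← compression_mul_left h S hM hN, compression_eq_one h hTS]
  · rw [← compression_mul_right h S hM, compression_eq_one h hST]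

theorem coe_pow_restrict_apply (hM : ∀ x ∈ M, T x ∈ M) (n : ℕ) (x : M) :
    ((T.restrict hM ^ n) x : X) = (T ^ n) x := by
  induction n generalizing x with
  | zero => rfl
  | succ n ih =>
    rw [pow_succ, pow_succ, mul_apply_eq_comp, mul_apply_eq_comp, ih]
    rfl

end TopCompl

section Translate

open Topology

theorem isUnit_sub_smul_one_iff {R A : Type*} [CommRing R] [Ring A] [Algebra R A] {a : A} {z : R} :
    IsUnit (a - z • (1 : A)) ↔ z ∉ spectrum R a := by
  rw [spectrum.notMem_iff, Algebra.algebraMap_eq_smul_one, IsUnit.sub_iff]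

theorem isUnit_sub_smul_one_of_isNilpotent {𝕜 A : Type*} [Field 𝕜] [Ring A] [Algebra 𝕜 A] {a : A}
    (ha : IsNilpotent a) {z : 𝕜} (hz : z ≠ 0) : IsUnit (a - z • (1 : A)) := by
  rw [← Algebra.algebraMap_eq_smul_one, sub_eq_add_neg]
  exact ha.isUnit_add_right_of_commute ((Units.mk0 z hz).isUnit.map (algebraMap 𝕜 A)).neg
    (Commute.neg_right (Algebra.commutes z a).symm)

theorem eventually_isUnit_sub_smul_one {𝕜 A : Type*} [NormedField 𝕜] [NormedRing A]
    [NormedAlgebra 𝕜 A] [CompleteSpace A] {a : A} (ha : IsUnit a) :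
    ∀ᶠ z in 𝓝 (0 : 𝕜), IsUnit (a - z • (1 : A)) := by
  have continuous_sub : Continuous fun z : 𝕜 => a - z • (1 : A) := by fun_prop
  exact continuous_sub.continuousAt.eventually_mem (Units.isOpen.mem_nhds (by simpa using ha))

end Translate

section Red

variable {X : Type*} [NormedAddCommGroup X] [NormedSpace ℂ X]

namespace Red

variable {T : X →L[ℂ] X} {M N : Submodule ℂ X}

theorem symm (h : Red T M N) : Red T N M :=
  ⟨h.isClosed_right, h.isClosed_left, h.invariant_right, h.invariant_left, h.isCompl.symm⟩

theorem sub_smul_one (h : Red T M N) (z : ℂ) : Red (T - z • (1 : X →L[ℂ] X)) M N where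
  isClosed_left := h.isClosed_left
  isClosed_right := h.isClosed_right
  invariant_left x hx := M.sub_mem (h.invariant_left x hx) (M.smul_mem z hx)
  invariant_right x hx := N.sub_mem (h.invariant_right x hx) (N.smul_mem z hx)
  isCompl := h.isCompl

variable [CompleteSpace X]

theorem isTopCompl (h : Red T M N) : Submodule.IsTopCompl M N :=
  Submodule.IsCompl.isTopCompl_of_isClosed h.isCompl h.isClosed_left h.isClosed_right

theorem isUnit_restrict_left (h : Red T M N) (hT : IsUnit T) :
    IsUnit (T.restrict h.invariant_left) := by
  obtain ⟨u, rfl⟩ := hT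
  exact isUnit_restrict h.isTopCompl h.invariant_left h.invariant_right (S := (↑u⁻¹ : X →L[ℂ] X))
    (fun x _ => DFunLike.congr_fun u.mul_inv x) fun x _ => DFunLike.congr_fun u.inv_mul x

end Red

theorem red_of_isIdempotentElem {T e : X →L[ℂ] X} (he : IsIdempotentElem e) (hTe : Commute T e) :
    Red T e.range e.ker where
  isClosed_left := (ContinuousLinearMap.IsIdempotentElem.isTopCompl he).isClosed
  isClosed_right := e.isClosed_ker
  invariant_left := range_invariant_of_commute hTe
  invariant_right := ker_invariant_of_commute hTe
  isCompl := (ContinuousLinearMap.IsIdempotentElem.isTopCompl he).isCompl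

end Red

/-! ### Drazin invertible and Browder operators -/

section Monoid

variable {R : Type*} [Monoid R] {t s : R} {k : ℕ}

theorem pow_succ_mul_eq_pow_of_le (h : t ^ (k + 1) * s = t ^ k) {l : ℕ} (hkl : k ≤ l) :
    t ^ (l + 1) * s = t ^ l := by
  obtain ⟨m, rfl⟩ := Nat.exists_eq_add_of_le' hkl
  rw [add_assoc, pow_add, mul_assoc, h, ← pow_add]

theorem pow_add_mul_pow_eq_pow (h : t ^ (k + 1) * s = t ^ k) (n : ℕ) :
    t ^ (k + n) * s ^ n = t ^ k := by
  induction n with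
  | zero => rw [add_zero, pow_zero, mul_one]
  | succ n ih =>
    rw [pow_succ', ← mul_assoc, ← add_assoc, pow_succ_mul_eq_pow_of_le h (k.le_add_right n), ih]

theorem exists_drazinInverse_of_commute (hts : Commute t s) (h : t ^ (k + 1) * s = t ^ k) :
    ∃ u, t * u = u * t ∧ u * t * u = u ∧ ∃ n : ℕ, t ^ (n + 1) * u = t ^ n := by
  have comm : Commute (t ^ k) (s ^ (k + 1)) := hts.pow_pow k (k + 1)
  have absorb : t ^ (k + 1) * (t ^ k * s ^ (k + 1)) = t ^ k := by
    rw [← mul_assoc, ← pow_add, add_right_comm, add_assoc, pow_add_mul_pow_eq_pow h]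
  refine ⟨t ^ k * s ^ (k + 1), ?_, ?_, k, absorb⟩
  · exact ((Commute.refl t).pow_right k).mul_right (hts.pow_right (k + 1))
  · calc t ^ k * s ^ (k + 1) * t * (t ^ k * s ^ (k + 1))
        = s ^ (k + 1) * (t ^ (k + 1) * (t ^ k * s ^ (k + 1))) := by
          simp only [comm.eq, pow_succ t k, mul_assoc]
      _ = t ^ k * s ^ (k + 1) := by rw [absorb, comm.eq]

end Monoid

section Drazin

open Topology

variable {X : Type*} [NormedAddCommGroup X] [NormedSpace ℂ X] {T : X →L[ℂ] X}

theorem isDrazinInvertible_of_isUnit (hT : IsUnit T) : IsDrazinInvertible T := by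
  obtain ⟨u, rfl⟩ := hT
  exact ⟨↑u⁻¹, by simp, by simp, 0, by simp⟩

theorem isDrazinInvertible_of_isNilpotent (hT : IsNilpotent T) : IsDrazinInvertible T := by
  obtain ⟨n, hn⟩ := hT
  exact ⟨0, by simp, by simp, n, by simp [hn]⟩

theorem IsDrazinInvertible.exists_red (hT : IsDrazinInvertible T) :
    ∃ (M N : Submodule ℂ X) (h : Red T M N), IsUnit (T.restrict h.invariant_left) ∧
      IsNilpotent (T.restrict h.invariant_right) := by
  obtain ⟨S, comm, absorb, k, hk⟩ := hT
  have idem : IsIdempotentElem (T * S) := by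
    rw [IsIdempotentElem, mul_assoc, ← mul_assoc S, absorb]
  have red := red_of_isIdempotentElem idem ((Commute.refl T).mul_right comm)
  have eq_self : ∀ x ∈ (T * S).range, T (S x) = x := by
    rintro _ ⟨x, rfl⟩
    exact DFunLike.congr_fun idem.eq x
  refine ⟨_, _, red, ?_, k, ?_⟩
  · exact isUnit_restrict (ContinuousLinearMap.IsIdempotentElem.isTopCompl idem) _
      red.invariant_right eq_self fun x hx => (DFunLike.congr_fun comm x).symm.trans (eq_self x hx)
  · ext x
    have hx : (T * S) (x : X) = 0 := x.2
    rw [coe_pow_restrict_apply, ← hk, pow_succ, mul_assoc, mul_apply_eq_comp, hx,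
      map_zero]
    rfl

section Glue

variable {M N : Submodule ℂ X}

theorem isDrazinInvertible_restrict (h : Submodule.IsTopCompl M N) (hM : ∀ x ∈ M, T x ∈ M)
    (hN : ∀ x ∈ N, T x ∈ N) (hT : IsDrazinInvertible T) : IsDrazinInvertible (T.restrict hM) := by
  obtain ⟨S, comm, -, k, hk⟩ := hT
  refine exists_drazinInverse_of_commute (s := compression h S) (k := k) ?_ ?_
  · rw [Commute, SemiconjBy, ← compression_mul_left h S hM hN, comm, compression_mul_right h S hM]
  · rw [← compression_pow_mul h S hM hN, hk, compression_pow h hM hN]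

theorem isDrazinInvertible_of_restrict (h : Submodule.IsTopCompl M N) {hM : ∀ x ∈ M, T x ∈ M}
    {hN : ∀ x ∈ N, T x ∈ N} (hTM : IsDrazinInvertible (T.restrict hM))
    (hTN : IsDrazinInvertible (T.restrict hN)) : IsDrazinInvertible T := by
  obtain ⟨U, commU, -, k, hk⟩ := hTM
  obtain ⟨V, commV, -, l, hl⟩ := hTN
  rw [← blockDiag_restrict h hM hN]
  refine exists_drazinInverse_of_commute (s := blockDiag h (U, V)) (k := max k l) ?_ ?_
  · exact Commute.map (Prod.ext commU commV) (blockDiag h)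
  · rw [← map_pow, ← map_mul, ← map_pow]
    exact congrArg (blockDiag h) (Prod.ext (pow_succ_mul_eq_pow_of_le hk (le_max_left k l))
      (pow_succ_mul_eq_pow_of_le hl (le_max_right k l)))

end Glue

theorem IsDrazinInvertible.eventually_isUnit [CompleteSpace X] (hT : IsDrazinInvertible T) :
    ∀ᶠ z in 𝓝[≠] (0 : ℂ), IsUnit (T - z • (1 : X →L[ℂ] X)) := by
  obtain ⟨M, N, h, hM, hN⟩ := hT.exists_red
  have := h.isClosed_left.completeSpace_coe
  filter_upwards [eventually_nhdsWithin_of_eventually_nhds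
      (eventually_isUnit_sub_smul_one (A := M →L[ℂ] M) hM), self_mem_nhdsWithin] with z hz hz0
  exact isUnit_of_isUnit_restrict h.isTopCompl (hM := (h.sub_smul_one z).invariant_left)
    (hN := (h.sub_smul_one z).invariant_right) hz (isUnit_sub_smul_one_of_isNilpotent hN hz0)

end Drazin

section Fredholm

variable {X : Type*} [NormedAddCommGroup X] [NormedSpace ℂ X] {T : X →L[ℂ] X}
  {M N : Submodule ℂ X}

theorem isFredholm_iff_exists_hasFiniteRange :
    T.IsFredholm ↔ ∃ S : X →L[ℂ] X, (S * T - 1).toLinearMap.HasFiniteRange ∧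
      (T * S - 1).toLinearMap.HasFiniteRange :=
  ContinuousLinearMap.isFredholm_iff_exists_isQuasiInverse.trans <| exists_congr fun _ =>
    and_congr LinearMap.FiniteRangeSetoid.equiv_iff_hasFiniteRange
      LinearMap.FiniteRangeSetoid.equiv_iff_hasFiniteRange

theorem isFredholm_of_isUnit (hT : IsUnit T) : T.IsFredholm := by
  obtain ⟨u, rfl⟩ := hT
  exact isFredholm_iff_exists_hasFiniteRange.2 ⟨↑u⁻¹, by simp, by simp⟩

theorem isFredholm_pow (hT : T.IsFredholm) (n : ℕ) : (T ^ n).IsFredholm := by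
  induction n with
  | zero => exact isFredholm_of_isUnit isUnit_one
  | succ n ih =>
    obtain ⟨S, hS⟩ := hT.exists_isQuasiInverse
    obtain ⟨S', hS'⟩ := ih.exists_isQuasiInverse
    rw [pow_succ]
    exact .of_isQuasiInverse (v := S * S') (hS.comp hS')

theorem hasFiniteRange_compression (h : Submodule.IsTopCompl M N)
    (hT : T.toLinearMap.HasFiniteRange) : (compression h T).toLinearMap.HasFiniteRange :=
  (hT.comp_right M.subtype).comp_left (M.projectionOntoL N h).toLinearMap

theorem hasFiniteRange_blockDiag (h : Submodule.IsTopCompl M N) {U : M →L[ℂ] M} {V : N →L[ℂ] N}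
    (hU : U.toLinearMap.HasFiniteRange) (hV : V.toLinearMap.HasFiniteRange) :
    (blockDiag h (U, V)).toLinearMap.HasFiniteRange := by
  change (ContinuousLinearMap.ofIsTopCompl h _ _).toLinearMap.HasFiniteRange
  rw [ContinuousLinearMap.ofIsTopCompl_eq_add]
  exact ((hU.comp_right (M.projectionOntoL N h).toLinearMap).comp_left M.subtype).add
    ((hV.comp_right (N.projectionOntoL M h.symm).toLinearMap).comp_left N.subtype)

theorem isFredholm_restrict (h : Submodule.IsTopCompl M N) (hM : ∀ x ∈ M, T x ∈ M)
    (hN : ∀ x ∈ N, T x ∈ N) (hT : T.IsFredholm) : (T.restrict hM).IsFredholm := by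
  obtain ⟨S, hl, hr⟩ := isFredholm_iff_exists_hasFiniteRange.1 hT
  have map_one : compression h 1 = 1 := compression_eq_one h fun _ _ => rfl
  refine isFredholm_iff_exists_hasFiniteRange.2 ⟨compression h S, ?_, ?_⟩
  · rw [← compression_mul_right h S hM, ← map_one, ← map_sub]
    exact hasFiniteRange_compression h hl
  · rw [← compression_mul_left h S hM hN, ← map_one, ← map_sub]
    exact hasFiniteRange_compression h hr

theorem isFredholm_of_restrict (h : Submodule.IsTopCompl M N) {hM : ∀ x ∈ M, T x ∈ M}
    {hN : ∀ x ∈ N, T x ∈ N} (hTM : (T.restrict hM).IsFredholm) (hTN : (T.restrict hN).IsFredholm) :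
    T.IsFredholm := by
  obtain ⟨U, hlU, hrU⟩ := isFredholm_iff_exists_hasFiniteRange.1 hTM
  obtain ⟨V, hlV, hrV⟩ := isFredholm_iff_exists_hasFiniteRange.1 hTN
  rw [← blockDiag_restrict h hM hN]
  refine isFredholm_iff_exists_hasFiniteRange.2 ⟨blockDiag h (U, V), ?_, ?_⟩
  · rw [← map_mul, ← map_one (blockDiag h), ← map_sub]
    exact hasFiniteRange_blockDiag h hlU hlV
  · rw [← map_mul, ← map_one (blockDiag h), ← map_sub]
    exact hasFiniteRange_blockDiag h hrU hrV

end Fredholm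

section Fitting

open LinearMap

variable {R M : Type*} [Ring R] [AddCommGroup M] [Module R M] {f : Module.End R M}

theorem range_pow_constant {k : ℕ} (h : (f ^ k).range = (f ^ (k + 1)).range) (m : ℕ) :
    (f ^ (k + m)).range = (f ^ k).range := by
  induction m with
  | zero => rfl
  | succ m ih =>
    rw [← ih, add_comm k m, add_comm k, add_assoc, add_comm 1, pow_add, pow_add _ m,
      Module.End.mul_eq_comp, Module.End.mul_eq_comp, range_comp, range_comp, h]

theorem isCompl_range_ker_of_mul_self {g : Module.End R M} (hker : (g * g).ker ≤ g.ker)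
    (hrange : g.range ≤ (g * g).range) : IsCompl g.range g.ker := by
  refine ⟨Submodule.disjoint_def.2 ?_, codisjoint_iff.2 (eq_top_iff.2 fun x _ => ?_)⟩
  · rintro _ ⟨x, rfl⟩ hx
    exact hker hx
  · obtain ⟨y, hy⟩ := hrange (mem_range_self g x)
    refine Submodule.mem_sup.2 ⟨g y, mem_range_self g y, x - g y, ?_, add_sub_cancel _ _⟩
    rw [mem_ker, map_sub, ← hy, Module.End.mul_apply, sub_self]

end Fitting

section Browder

variable {X : Type*} [NormedAddCommGroup X] [NormedSpace ℂ X] {T : X →L[ℂ] X}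

theorem IsDrazinInvertible.hasFiniteAscent (hT : IsDrazinInvertible T) : HasFiniteAscent T := by
  obtain ⟨S, comm, -, k, hk⟩ := hT
  refine ⟨k, le_antisymm (fun x hx => ?_) fun x hx => ?_⟩
  · have hx : (T ^ k) x = 0 := hx
    change (T ^ (k + 1)) x = 0
    rw [pow_succ', mul_apply_eq_comp, hx, map_zero]
  · have hx : (T ^ (k + 1)) x = 0 := hx
    change (T ^ k) x = 0
    rw [← hk, (Commute.pow_left comm (k + 1)).eq, mul_apply_eq_comp, hx, map_zero]

theorem IsDrazinInvertible.hasFiniteDescent (hT : IsDrazinInvertible T) : HasFiniteDescent T := by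
  obtain ⟨S, -, -, k, hk⟩ := hT
  refine ⟨k, le_antisymm ?_ ?_⟩
  · rintro _ ⟨x, rfl⟩
    exact ⟨S x, DFunLike.congr_fun hk x⟩
  · rintro _ ⟨x, rfl⟩
    exact ⟨T x, rfl⟩

theorem exists_ker_pow_add_eq_and_range_pow_add_eq (hA : HasFiniteAscent T)
    (hD : HasFiniteDescent T) :
    ∃ n, ∀ m, (T ^ (n + m)).ker = (T ^ n).ker ∧ (T ^ (n + m)).range = (T ^ n).range := by
  obtain ⟨a, ha⟩ := hA
  obtain ⟨d, hd⟩ := hD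
  simp only [ContinuousLinearMap.toLinearMap_pow] at ha hd ⊢
  refine ⟨a + d, fun m => ⟨?_, ?_⟩⟩
  · rw [add_assoc, ← Module.End.ker_pow_constant ha, ← Module.End.ker_pow_constant ha]
  · rw [add_comm a, add_assoc, range_pow_constant hd, range_pow_constant hd]

theorem IsBrowder.exists_red [CompleteSpace X] (hT : IsBrowder T) :
    ∃ (M N : Submodule ℂ X) (h : Red T M N), IsUnit (T.restrict h.invariant_left) ∧
      IsNilpotent (T.restrict h.invariant_right) := by
  obtain ⟨n, hn⟩ := exists_ker_pow_add_eq_and_range_pow_add_eq hT.2.1 hT.2.2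
  have isCompl : IsCompl (T ^ n).range (T ^ n).ker := by
    refine isCompl_range_ker_of_mul_self ?_ ?_
    · change (T ^ n * T ^ n).ker ≤ _
      rw [← pow_add, (hn n).1]
    · change _ ≤ (T ^ n * T ^ n).range
      rw [← pow_add, (hn n).2]
  have red : Red T (T ^ n).range (T ^ n).ker :=
    ⟨(isFredholm_pow hT.1 n).isClosed_range, (T ^ n).isClosed_ker,
      range_invariant_of_commute ((Commute.refl T).pow_right n),
      ker_invariant_of_commute ((Commute.refl T).pow_right n), isCompl⟩
  have := red.isClosed_left.completeSpace_coe
  refine ⟨_, _, red, ContinuousLinearMap.isUnit_iff_bijective.2 ⟨?_, ?_⟩, n, ?_⟩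
  · rw [injective_iff_map_eq_zero]
    rintro ⟨_, x, rfl⟩ hx
    refine Subtype.ext ((hn 1).1.le ?_)
    rw [pow_succ']
    exact congrArg Subtype.val hx
  · rintro ⟨_, x, rfl⟩
    obtain ⟨y, hy⟩ := (hn 1).2.ge ⟨x, rfl⟩
    refine ⟨⟨(T ^ n) y, y, rfl⟩, Subtype.ext ?_⟩
    rw [pow_succ'] at hy
    exact hy
  · ext x
    rw [coe_pow_restrict_apply]
    exact x.2

theorem isBrowder_iff [CompleteSpace X] : IsBrowder T ↔ T.IsFredholm ∧ IsDrazinInvertible T := by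
  refine ⟨fun hT => ⟨hT.1, ?_⟩, fun ⟨hF, hD⟩ => ⟨hF, hD.hasFiniteAscent, hD.hasFiniteDescent⟩⟩
  obtain ⟨M, N, h, hM, hN⟩ := hT.exists_red
  exact isDrazinInvertible_of_restrict h.isTopCompl (isDrazinInvertible_of_isUnit hM)
    (isDrazinInvertible_of_isNilpotent hN)

end Browder

/-! ### The spectra `σ_*` -/

section SigmaStar

open CantorBendixson Filter Set Topology

variable {X : Type*} [NormedAddCommGroup X] [NormedSpace ℂ X] {T : X →L[ℂ] X}
  {M N : Submodule ℂ X} {k : SpectrumKind} {z : ℂ}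

/-- The invertibility notion whose spectrum is `σ_*`: being invertible, a Browder operator or Drazin
invertible. It lets the three spectra be treated at once. -/
def IsStarInvertible (k : SpectrumKind) (T : X →L[ℂ] X) : Prop :=
  match k with
  | .ordinary => IsUnit T
  | .browder => IsBrowder T
  | .drazin => IsDrazinInvertible T

theorem notMem_sigmaStar_iff :
    z ∉ sigmaStar k T ↔ IsStarInvertible k (T - z • (1 : X →L[ℂ] X)) := by
  cases k with
  | ordinary => exact isUnit_sub_smul_one_iff.symm
  | browder => exact not_not
  | drazin => exact not_not

theorem sigmaStar_sub_smul_one (z : ℂ) :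
    sigmaStar k (T - z • (1 : X →L[ℂ] X)) = Homeomorph.addRight z ⁻¹' sigmaStar k T := by
  ext w
  rw [← not_iff_not, mem_preimage, Homeomorph.coe_addRight, notMem_sigmaStar_iff,
    notMem_sigmaStar_iff, sub_sub, ← add_smul, add_comm]

variable [CompleteSpace X]

theorem isStarInvertible_of_isUnit (hT : IsUnit T) : IsStarInvertible k T := by
  cases k with
  | ordinary => exact hT
  | browder => exact isBrowder_iff.2 ⟨isFredholm_of_isUnit hT, isDrazinInvertible_of_isUnit hT⟩
  | drazin => exact isDrazinInvertible_of_isUnit hT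

theorem IsStarInvertible.isDrazinInvertible (hT : IsStarInvertible k T) :
    IsDrazinInvertible T := by
  cases k with
  | ordinary => exact isDrazinInvertible_of_isUnit hT
  | browder => exact (isBrowder_iff.1 hT).2
  | drazin => exact hT

theorem Red.isStarInvertible_restrict_left (h : Red T M N) (hT : IsStarInvertible k T) :
    IsStarInvertible k (T.restrict h.invariant_left) := by
  have := h.isClosed_left.completeSpace_coe
  have isDrazinInvertible : IsDrazinInvertible (T.restrict h.invariant_left) :=
    isDrazinInvertible_restrict h.isTopCompl _ h.invariant_right hT.isDrazinInvertible
  cases k with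
  | ordinary => exact h.isUnit_restrict_left hT
  | browder =>
    exact isBrowder_iff.2
      ⟨isFredholm_restrict h.isTopCompl _ h.invariant_right hT.1, isDrazinInvertible⟩
  | drazin => exact isDrazinInvertible

theorem Red.isStarInvertible_of_restrict (h : Red T M N)
    (hM : IsStarInvertible k (T.restrict h.invariant_left))
    (hN : IsStarInvertible k (T.restrict h.invariant_right)) : IsStarInvertible k T := by
  have := h.isClosed_left.completeSpace_coe
  have := h.isClosed_right.completeSpace_coe
  have isDrazinInvertible : IsDrazinInvertible T :=
    isDrazinInvertible_of_restrict h.isTopCompl hM.isDrazinInvertible hN.isDrazinInvertible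
  cases k with
  | ordinary => exact isUnit_of_isUnit_restrict h.isTopCompl hM hN
  | browder =>
    exact isBrowder_iff.2 ⟨isFredholm_of_restrict h.isTopCompl hM.1 hN.1, isDrazinInvertible⟩
  | drazin => exact isDrazinInvertible

theorem Red.sigmaStar_eq_union (k : SpectrumKind) (h : Red T M N) :
    sigmaStar k T =
      sigmaStar k (T.restrict h.invariant_left) ∪ sigmaStar k (T.restrict h.invariant_right) := by
  ext z
  have hz := h.sub_smul_one z
  rw [← not_iff_not, mem_union, not_or, notMem_sigmaStar_iff, notMem_sigmaStar_iff,
    notMem_sigmaStar_iff]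
  exact ⟨fun hT =>
      ⟨hz.isStarInvertible_restrict_left hT, hz.symm.isStarInvertible_restrict_left hT⟩,
    fun hT => hz.isStarInvertible_of_restrict hT.1 hT.2⟩

theorem sigmaStar_subset_spectrum : sigmaStar k T ⊆ spectrum ℂ T := by
  refine compl_subset_compl.1 fun z hz => notMem_sigmaStar_iff.2 (isStarInvertible_of_isUnit ?_)
  exact isUnit_sub_smul_one_iff.2 hz

theorem eventually_notMem_spectrum_of_notMem_sigmaStar (hz : z ∉ sigmaStar k T) :
    ∀ᶠ w in 𝓝[≠] z, w ∉ spectrum ℂ T := by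
  have tendsto_sub : Tendsto (· - z) (𝓝[≠] z) (𝓝[≠] 0) := by
    have h := (continuous_sub_right z).continuousWithinAt.tendsto_nhdsWithin (x := z)
      (s := {z}ᶜ) (t := {0}ᶜ) fun w hw => sub_ne_zero.2 hw
    rwa [sub_self] at h
  filter_upwards [tendsto_sub.eventually
    (notMem_sigmaStar_iff.1 hz).isDrazinInvertible.eventually_isUnit] with w hw
  rwa [sub_sub, ← add_smul, add_sub_cancel, isUnit_sub_smul_one_iff] at hw

theorem isClosed_sigmaStar : IsClosed (sigmaStar k T) := by
  rw [← isOpen_compl_iff, isOpen_iff_eventually]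
  intro z hz
  have h := (eventually_notMem_spectrum_of_notMem_sigmaStar hz).mono fun w hw =>
    mt (sigmaStar_subset_spectrum (k := k) ·) hw
  rwa [← nhdsNE_sup_pure, eventually_sup, eventually_pure, and_iff_left hz]

theorem countable_spectrum_diff_sigmaStar : (spectrum ℂ T \ sigmaStar k T).Countable := by
  refine (countable_diff_iteratedDerivedSet (spectrum ℂ T) 1).mono ?_
  refine fun z hz => ⟨hz.1, fun hz' => ?_⟩
  rw [← zero_add (1 : Ordinal), iteratedDerivedSet_succ, iteratedDerivedSet_zero] at hz'
  exact accPt_iff_frequently_nhdsNE.1 hz'.1 (eventually_notMem_spectrum_of_notMem_sigmaStar hz.2)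

theorem countable_spectrum_inter {U : Set ℂ} (hU : (sigmaStar k T ∩ U).Countable) :
    (spectrum ℂ T ∩ U).Countable := by
  refine (hU.union (countable_spectrum_diff_sigmaStar (k := k) (T := T))).mono ?_
  rintro z ⟨hz, hzU⟩
  by_cases hzk : z ∈ sigmaStar k T
  · exact Or.inl ⟨hzk, hzU⟩
  · exact Or.inr ⟨hz, hzk⟩

theorem Red.eventually_mem_sigmaStar_restrict_right (k : SpectrumKind) (h : Red T M N)
    (hM : IsUnit (T.restrict h.invariant_left)) :
    ∀ᶠ z in 𝓝 (0 : ℂ), z ∈ sigmaStar k T → z ∈ sigmaStar k (T.restrict h.invariant_right) := by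
  have := h.isClosed_left.completeSpace_coe
  filter_upwards [eventually_isUnit_sub_smul_one (A := M →L[ℂ] M) hM] with z hz hzT
  rw [h.sigmaStar_eq_union k] at hzT
  exact hzT.resolve_left fun hzM =>
    isUnit_sub_smul_one_iff.1 hz (sigmaStar_subset_spectrum hzM)

end SigmaStar

/-! ### Splitting off the part of the spectrum near `0` -/

section Splitting

open Metric Set Topology

theorem exists_disjoint_sphere_of_countable {α : Type*} [PseudoMetricSpace α] {c : α}
    {K U : Set α} (hU : U ∈ 𝓝 c) (hK : (K ∩ U).Countable) :
    ∃ r > 0, closedBall c r ⊆ U ∧ Disjoint (sphere c r) K := by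
  obtain ⟨ε, hε, hεU⟩ := nhds_basis_ball.mem_iff.1 hU
  obtain ⟨r, hr, hr0, hrε⟩ := ((hK.image (dist · c)).dense_compl ℝ).exists_between hε
  have closedBall_subset : closedBall c r ⊆ U := (closedBall_subset_ball hrε).trans hεU
  exact ⟨r, hr0, closedBall_subset, disjoint_left.2 fun z hz hzK =>
    hr ⟨z, ⟨hzK, closedBall_subset (sphere_subset_closedBall hz)⟩, hz⟩⟩

variable {X : Type*} [NormedAddCommGroup X] [NormedSpace ℂ X] [CompleteSpace X] {T : X →L[ℂ] X}
  {M N : Submodule ℂ X}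

theorem Red.notMem_spectrum_restrict_left {S : X →L[ℂ] X} {z : ℂ} (h : Red T M N)
    (hTS : Commute T S) (hS : ∀ x ∈ M, ((T - z • (1 : X →L[ℂ] X)) * S) x = x) :
    z ∉ spectrum ℂ (T.restrict h.invariant_left) := by
  have hz := h.sub_smul_one z
  have comm : Commute (T - z • (1 : X →L[ℂ] X)) S := hTS.sub_left ((Commute.one_left S).smul_left z)
  exact isUnit_sub_smul_one_iff.1 <| isUnit_restrict hz.isTopCompl hz.invariant_left
    hz.invariant_right hS fun x hx => (DFunLike.congr_fun comm.eq x).symm.trans (hS x hx)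

theorem exists_red_of_sphere_subset_resolventSet {c : ℂ} {r : ℝ} (hr : 0 < r)
    (h : sphere c r ⊆ resolventSet ℂ T) :
    ∃ (M N : Submodule ℂ X) (hMN : Red T M N),
      spectrum ℂ (T.restrict hMN.invariant_left) ⊆ (ball c r)ᶜ ∧
      spectrum ℂ (T.restrict hMN.invariant_right) ⊆ closedBall c r := by
  have idem := isIdempotentElem_rieszProjection hr h
  have red := red_of_isIdempotentElem idem (commute_rieszProjection hr.le h)
  refine ⟨_, _, red.symm, subset_compl_comm.1 fun z hz => ?_, compl_subset_compl.1 fun z hz => ?_⟩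
  · refine red.symm.notMem_spectrum_restrict_left (commute_cauchyResolvent hr.le h (ne_of_lt hz))
      fun x hx => ?_
    have hx : rieszProjection T c r x = 0 := hx
    rw [← Algebra.algebraMap_eq_smul_one, ← neg_sub, neg_mul,
      sub_mul_cauchyResolvent_of_mem_ball h hz, neg_sub]
    exact (congrArg (x - ·) hx).trans (sub_zero x)
  · refine red.notMem_spectrum_restrict_left
      (commute_cauchyResolvent hr.le h (mt (sphere_subset_closedBall ·) hz)).neg_right ?_
    rintro _ ⟨x, rfl⟩
    rw [← Algebra.algebraMap_eq_smul_one, mul_neg, ← neg_mul, neg_sub,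
      sub_mul_cauchyResolvent_of_notMem_closedBall hr.le h hz]
    exact DFunLike.congr_fun idem.eq x

theorem exists_red_of_countable {U : Set ℂ} (hU : U ∈ 𝓝 0) (hc : (spectrum ℂ T ∩ U).Countable) :
    ∃ (M N : Submodule ℂ X) (h : Red T M N), IsUnit (T.restrict h.invariant_left) ∧
      spectrum ℂ (T.restrict h.invariant_right) ⊆ U := by
  obtain ⟨r, hr, hrU, disj⟩ := exists_disjoint_sphere_of_countable hU hc
  obtain ⟨M, N, h, hM, hN⟩ := exists_red_of_sphere_subset_resolventSet hr
    fun z hz => not_not.1 (disjoint_left.1 disj hz)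
  refine ⟨M, N, h, ?_, hN.trans hrU⟩
  rw [← spectrum.zero_notMem_iff ℂ]
  exact fun h0 => hM h0 (mem_ball_self hr)

end Splitting

/-! ### Almost invertible and `g`-invertible operators -/

section Characterizations

open Set

variable {X : Type*} [NormedAddCommGroup X] [NormedSpace ℂ X] [CompleteSpace X] {T : X →L[ℂ] X}

theorem almostInvertible_iff (k : SpectrumKind) :
    AlmostInvertible T ↔ (0 : ℂ) ∉ accIter (sigmaStar k T) ω₁ := by
  rw [accIter_omega_one isClosed_sigmaStar, notMem_perfectKernel_iff isClosed_sigmaStar]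
  constructor
  · rintro ⟨M, N, h, hM, hN⟩
    refine ⟨_, h.eventually_mem_sigmaStar_restrict_right .ordinary hM, hN.mono ?_⟩
    exact fun z ⟨hz, hzU⟩ => hzU (sigmaStar_subset_spectrum hz)
  · rintro ⟨U, hU, hc⟩
    replace hc := countable_spectrum_inter hc
    obtain ⟨M, N, h, hM, hN⟩ := exists_red_of_countable hU hc
    refine ⟨M, N, h, hM, hc.mono (subset_inter ?_ hN)⟩
    exact subset_union_right.trans (h.sigmaStar_eq_union .ordinary).ge

variable {k : SpectrumKind}

theorem gInvertibleSucc_iff {β : Ordinal.{0}} :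
    GInvertibleSucc k T β ↔ (0 : ℂ) ∉ accIter (sigmaStar k T) (β + 1) := by
  rw [accIter_add_one, mem_derivedSet, accPt_iff_nhds]
  push Not
  constructor
  · rintro ⟨M, N, h, hM, hN⟩
    obtain ⟨U, hUs, hU, h0⟩ :=
      _root_.mem_nhds_iff.1 (h.eventually_mem_sigmaStar_restrict_right k hM)
    refine ⟨U, hU.mem_nhds h0, fun y hy => hN ?_⟩
    exact accIter_inter_subset hU (fun z hz => hUs hz.2 hz.1) β ⟨hy.2, hy.1⟩
  · rintro ⟨U, hU, h0⟩
    have hc : (sigmaStar k T ∩ U).Countable := by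
      refine ((countable_diff_accIter (isClosed_sigmaStar (k := k) (T := T)) β).union
        (countable_singleton 0)).mono fun z ⟨hz, hzU⟩ => ?_
      by_cases hzβ : z ∈ accIter (sigmaStar k T) β
      · exact Or.inr (h0 z ⟨hzU, hzβ⟩)
      · exact Or.inl ⟨hz, hzβ⟩
    obtain ⟨M, N, h, hM, hN⟩ := exists_red_of_countable hU (countable_spectrum_inter hc)
    have := h.isClosed_right.completeSpace_coe
    refine ⟨M, N, h, hM, fun z hz => h0 z ⟨hN (sigmaStar_subset_spectrum (k := k) ?_), ?_⟩⟩
    · exact accIter_subset isClosed_sigmaStar β hz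
    · exact accIter_mono (subset_union_right.trans (h.sigmaStar_eq_union k).ge) β hz

theorem gInvertible_iff {α : Ordinal.{0}} :
    GInvertible k T α ↔ (0 : ℂ) ∉ accIter (sigmaStar k T) α := by
  have antitone : Antitone (accIter (sigmaStar k T)) := accIter_antitone isClosed_sigmaStar
  simp only [GInvertible, gInvertibleSucc_iff]
  constructor
  · rintro (⟨rfl, h⟩ | ⟨β, rfl, h⟩ | ⟨-, β, hβ, h⟩)
    · rwa [accIter_zero]
    · exact h
    · exact mt (antitone hβ.le ·) h
  · intro h
    rcases Ordinal.zero_or_succ_or_isSuccLimit α with rfl | ⟨β, rfl⟩ | hα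
    · exact Or.inl ⟨rfl, by rwa [accIter_zero] at h⟩
    · exact Or.inr (Or.inl ⟨β, rfl, h⟩)
    · rw [accIter_limit _ hα] at h
      simp only [mem_iInter, not_forall] at h
      obtain ⟨β, hβ, h⟩ := h
      exact Or.inr (Or.inr ⟨hα, β, hα.add_one_lt hβ, mt (antitone (Order.le_succ β) ·) h⟩)

theorem sigmaAl_eq_accIter : sigmaAl T = accIter (sigmaStar k T) ω₁ := by
  ext z
  rw [sigmaAl, mem_ofPred_eq, almostInvertible_iff k, not_not, sigmaStar_sub_smul_one,
    accIter_preimage_homeomorph, mem_preimage, Homeomorph.coe_addRight]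
  exact iff_of_eq (congrArg (· ∈ _) (zero_add z))

end Characterizations

end AlmostInv

end

theorem mainTheorem1 {X : Type*} [NormedAddCommGroup X] [NormedSpace ℂ X] [CompleteSpace X]
    (k : AlmostInv.SpectrumKind) :
    (∀ T : X →L[ℂ] X,
      (AlmostInv.AlmostInvertible T ↔ AlmostInv.GInvertible k T ω₁) ∧
      (AlmostInv.GInvertible k T ω₁ ↔
        AlmostInv.GInvertible k T (AlmostInv.cbRank (AlmostInv.sigmaStar k T))) ∧
      AlmostInv.sigmaAl T = AlmostInv.accIter (AlmostInv.sigmaStar k T) ω₁ ∧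
      AlmostInv.accIter (AlmostInv.sigmaStar k T) ω₁ =
        AlmostInv.accIter (AlmostInv.sigmaStar k T)
          (AlmostInv.cbRank (AlmostInv.sigmaStar k T)) ∧
      (AlmostInv.AlmostInvertible T ↔ (0 : ℂ) ∉ AlmostInv.accIter (spectrum ℂ T) ω₁)) ∧
    {T : X →L[ℂ] X | AlmostInv.AlmostInvertible T} =
      {T : X →L[ℂ] X | AlmostInv.GInvertible k T ω₁} ∧
    {T : X →L[ℂ] X | AlmostInv.GInvertible k T ω₁} =
      {T : X →L[ℂ] X |
        AlmostInv.GInvertible k T (AlmostInv.cbRank (AlmostInv.sigmaStar k T))} := by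
  have isClosed (T : X →L[ℂ] X) : IsClosed (AlmostInv.sigmaStar k T) :=
    AlmostInv.isClosed_sigmaStar
  have accIter_eq (T : X →L[ℂ] X) := (AlmostInv.accIter_cbRank_eq_omega_one (isClosed T)).symm
  have almostInvertible_iff_omega_one (T : X →L[ℂ] X) :
      AlmostInv.AlmostInvertible T ↔ AlmostInv.GInvertible k T ω₁ :=
    (AlmostInv.almostInvertible_iff k).trans AlmostInv.gInvertible_iff.symm
  have omega_one_iff_cbRank (T : X →L[ℂ] X) : AlmostInv.GInvertible k T ω₁ ↔
      AlmostInv.GInvertible k T (AlmostInv.cbRank (AlmostInv.sigmaStar k T)) := by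
    rw [AlmostInv.gInvertible_iff, AlmostInv.gInvertible_iff, accIter_eq]
  exact ⟨fun T => ⟨almostInvertible_iff_omega_one T, omega_one_iff_cbRank T,
    AlmostInv.sigmaAl_eq_accIter, accIter_eq T, AlmostInv.almostInvertible_iff .ordinary⟩,
    Set.ext almostInvertible_iff_omega_one, Set.ext omega_one_iff_cbRank⟩
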